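/- Let $(G,\tau)$ be a Polish group (a topological group whose topology is Polish) and let $\partial$ be a distance on $G$ making $(G,\tau,\partial)$ a topometric group; that is, $\partial$ is bi-invariant, the topology induced by $\partial$ refines $\tau$, and $\partial$ is $\tau$-lower semi-continuous, i.e. $\{(x,y)\in G^2 : \partial(x,y)\le r\}$ is $\tau\times\tau$-closed for every $r\in\mathbb{R}$. For a set $X$ with a distance $\partial$, $A\subseteq X$ and $\varepsilon>0$, write $(A)_\varepsilon=\{x\in X : \exists a\in A,\ \partial(x,a)<\varepsilon\}$. Assume that $(G,\tau,\partial)$ has ample generics: for every $n\in\mathbb{N}$ and every $\varepsilon>0$ there is $\bar x=(x_1,\dots,x_n)\in G^n$ whose diagonal conjugacy class $C(\bar x)=\{(gx_1g^{-1},\dots,gx_ng^{-1}) : g\in G\}$ is such that $(C(\bar x))_\varepsilon$ is co-meagre in $G^n$, where $G^n$ carries the product topology of $\tau$ and the enlargement is taken for the supremum distance of $\partial$. **Theorem.** Let $k_n\in G$ and $A_n\subseteq G$ for $n\in\mathbb{N}$ be such that $\bigcup_{n\in\mathbb{N}}k_nA_n$ is co-meagre in $(G,\tau)$. Then there is some $n\in\mathbb{N}$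 such that for all $\varepsilon>0$, $$1_G\in\operatorname{Int}_\tau\Bigl(\bigl(A_n^{-1}A_nA_n^{-1}A_n^{-1}A_nA_n^{-1}A_nA_nA_n^{-1}A_n\bigr)_\varepsilon\Bigr).$$ Here $A_n^{-1}=\{a^{-1}:a\in A_n\}$ and products of sets are element-wise. -/

import Mathlib

open scoped Pointwise

/-- `(X, τ, d)` is a topometric space: `d` is a distance on the topological space `X` whose
topology refines that of `X`, and `d` is lower semi-continuous for the topology of `X`.
The distance is kept as a plain function, so that the only topology on `X` known to the system
is `τ`. -/
structure IsTopometricSpace {X : Type*} [TopologicalSpace X] (d : X → X → ℝ) : Prop where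
  dist_self : ∀ x, d x x = 0
  eq_of_dist_eq_zero : ∀ x y, d x y = 0 → x = y
  dist_comm : ∀ x y, d x y = d y x
  dist_triangle : ∀ x y z, d x z ≤ d x y + d y z
  refines : ∀ U : Set X, IsOpen U → ∀ x ∈ U, ∃ r > 0, ∀ y, d x y < r → y ∈ U
  isClosed_le : ∀ r : ℝ, IsClosed {p : X × X | d p.1 p.2 ≤ r}

/-- The distance `d` turns the topological group `G` into a topometric group: `(G, τ, d)` is a
topometric space and `d` is bi-invariant. -/
structure IsTopometricGroup {G : Type*} [Group G] [TopologicalSpace G] [IsTopologicalGroup G]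
    (d : G → G → ℝ) : Prop where
  isTopometricSpace : IsTopometricSpace d
  dist_mul_left : ∀ g x y, d (g * x) (g * y) = d x y
  dist_mul_right : ∀ g x y, d (x * g) (y * g) = d x y

/-- The `ε`-enlargement `(A)_ε` of `A`: the points at `d`-distance less than `ε` from `A`
(it is empty when `A` is). -/
def enlargement {X : Type*} (d : X → X → ℝ) (A : Set X) (ε : ℝ) : Set X :=
  {x | ∃ a ∈ A, d x a < ε}

/-- The supremum distance on `X ^ n` (it is `0` for `n = 0`). -/
noncomputable def supDist {X : Type*} (d : X → X → ℝ) (n : ℕ) (x y : Fin n → X) : ℝ :=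
  ⨆ i, d (x i) (y i)

/-- The action of `M` on the topometric space `(X, τ, d)` has ample generics: for all `n` and
`ε > 0` some orbit of the diagonal action on `X ^ n` has an `ε`-enlargement that is co-meagre
(membership in the filter `residual`) in the product topology. -/
def ActionHasAmpleGenerics (M : Type*) {X : Type*} [Group M] [MulAction M X]
    [TopologicalSpace X] (d : X → X → ℝ) : Prop :=
  ∀ (n : ℕ) (ε : ℝ), 0 < ε → ∃ x : Fin n → X,
    enlargement (supDist d n) (MulAction.orbit M x) ε ∈ residual (Fin n → X)

/-- `(G, τ, d)` has ample generics: the action of `G` on itself by conjugation does. -/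
def HasAmpleGenerics {G : Type*} [Group G] [TopologicalSpace G] (d : G → G → ℝ) : Prop :=
  ActionHasAmpleGenerics (ConjAct G) d

/-!
The proof follows the classical argument that a Polish group with ample generics has the Steinhaus
property, with every exact equality of conjugates replaced by an approximate one for `d`.

Write `D = A⁻¹ * A * A⁻¹ * A⁻¹ * A`, so that the ten-fold product is `D * D⁻¹`. If the enlargement
`(D)_δ` is co-meagre in a nonempty open set, then by Pettis' theorem
(`mul_inv_mem_nhds_one_of_isMeagre_diff`) and bi-invariance `(D * D⁻¹)_{2δ}` is a neighbourhood
of `1`. So if the conclusion fails, then for each `n` there is `δ n > 0` such that the complement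
`Y n` of `(D n)_{δ n}` is non-meagre in every nonempty open set. Moreover, the translates
`k n • A n` with `A n` non-meagre still cover a co-meagre set; for these `X n = (A n)⁻¹` is
non-meagre.

Ample generics allow a continuous family `H a`, indexed by the Cantor space, such that whenever `a`
and `b` split at `n`, some `H a`-conjugate of an element of `X n` is close to some `H b`-conjugate
of an element of `Y n` (`IsTopometricGroup.exists_continuous_tree`; each index is in fact repeated
infinitely often). By a Kuratowski–Ulam argument some translate of `H` maps a non-meagre set of
branches into a single `k n • A n`. Two of these branches `a`, `b` split at a level attached to this
`n`; then `(H b)⁻¹ * H a ∈ (A n)⁻¹ * A n` conjugates some `x ∈ (A n)⁻¹` to within `δ n` of some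
`y ∈ Y n`. The conjugate lies in `D n`, which contradicts the choice of `Y n`.

The extension step of the tree (`IsTopometricGroup.exists_isGenericTuple_cons_conj_le`) rests on the
following: if `(a, x)` is generic, then the conjugates of `a` by the elements near `1` that almost
fix `x` come close to almost every element of some nonempty open set. Genericity and a countable
covering show that the set of elements so approached is non-meagre; it is analytic because `d` is
lower semi-continuous, and a non-meagre analytic set is co-meagre in some nonempty open set
(`exists_isOpen_isMeagre_diff_range`).
-/

open Set Filter Topology

/-! ### Baire category -/

instance residual.instNeBot {X : Type*} [TopologicalSpace X] [BaireSpace X] [Nonempty X] :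
    (residual X).NeBot :=
  ⟨fun h ↦ not_nonempty_empty (dense_of_mem_residual (empty_mem_iff_bot.2 h)).nonempty⟩

/-- The easy half of the Kuratowski–Ulam theorem. -/
theorem eventually_residual_prod {X Y : Type*} [TopologicalSpace X] [TopologicalSpace Y]
    [SecondCountableTopology Y] {s : Set (X × Y)} (hs : s ∈ residual (X × Y)) :
    ∀ᶠ x in residual X, ∀ᶠ y in residual Y, (x, y) ∈ s := by
  obtain ⟨S, hSo, hSd, hSc, hSs⟩ := mem_residual_iff.1 hs
  suffices h : ∀ t ∈ S, ∀ᶠ x in residual X, ∀ᶠ y in residual Y, (x, y) ∈ t by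
    filter_upwards [(eventually_countable_ball hSc).2 h] with x hx
    filter_upwards [(eventually_countable_ball hSc).2 hx] with y hy
    exact hSs hy
  intro t ht
  -- The section of `t` at `x` is dense as soon as it meets every basic open set.
  suffices h : ∀ V ∈ TopologicalSpace.countableBasis Y,
      ∀ᶠ x in residual X, ∃ y ∈ V, (x, y) ∈ t by
    filter_upwards [(eventually_countable_ball (TopologicalSpace.countable_countableBasis Y)).2 h]
      with x hx
    refine residual_of_dense_open ((hSo t ht).preimage (by fun_prop : Continuous fun y ↦ (x, y))) ?_
    refine (TopologicalSpace.isBasis_countableBasis Y).dense_iff.2 fun V hV _ ↦ ?_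
    obtain ⟨y, hyV, hy⟩ := hx V hV
    exact ⟨y, hyV, hy⟩
  intro V hV
  have hVo := TopologicalSpace.isOpen_of_mem_countableBasis hV
  have heq : {x | ∃ y ∈ V, (x, y) ∈ t} = Prod.fst '' (t ∩ univ ×ˢ V) := by
    ext x; simp [and_comm]
  change {x | ∃ y ∈ V, (x, y) ∈ t} ∈ residual X
  rw [heq]
  refine residual_of_dense_open
    (isOpenMap_fst _ ((hSo t ht).inter (isOpen_univ.prod hVo))) ?_
  refine dense_iff_inter_open.2 fun U hU hUne ↦ ?_
  obtain ⟨p, hpUV, hpt⟩ := (hSd t ht).inter_open_nonempty _ (hU.prod hVo)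
    (hUne.prod (TopologicalSpace.nonempty_of_mem_countableBasis hV))
  exact ⟨p.1, hpUV.1, p, ⟨hpt, mem_univ _, hpUV.2⟩, rfl⟩

/-- `Fin.cons` as a homeomorphism; the tail is the first component of the product, so that
Kuratowski–Ulam fixes the tail and varies the new entry. -/
def Homeomorph.finCons (X : Type*) [TopologicalSpace X] (n : ℕ) :
    (Fin n → X) × X ≃ₜ (Fin (n + 1) → X) where
  toFun p := Fin.cons p.2 p.1
  invFun z := (Fin.tail z, z 0)
  left_inv p := by simp
  right_inv z := by simp
  continuous_toFun := Continuous.finCons (A := fun _ ↦ X) continuous_snd continuous_fst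
  continuous_invFun := by unfold Fin.tail; fun_prop

theorem eventually_residual_finCons {X : Type*} [TopologicalSpace X] [SecondCountableTopology X]
    {n : ℕ} {s : Set (Fin (n + 1) → X)} (hs : s ∈ residual (Fin (n + 1) → X)) :
    ∀ᶠ x in residual (Fin n → X), ∀ᶠ y in residual X, (Fin.cons y x : Fin (n + 1) → X) ∈ s :=
  eventually_residual_prod (tendsto_residual_of_isOpenMap (Homeomorph.finCons X n).continuous
    (Homeomorph.finCons X n).isOpenMap hs)

theorem IsOpen.isMeagre_closure_diff {X : Type*} [TopologicalSpace X] {U : Set X}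
    (hU : IsOpen U) : IsMeagre (closure U \ U) := by
  have h : closure U \ U = frontier U := by rw [frontier, hU.interior_eq]
  rw [h]
  refine IsNowhereDense.isMeagre ?_
  rw [isClosed_frontier.isNowhereDense_iff, ← frontier_compl,
    interior_frontier hU.isClosed_compl]

/-- Every set `P` is contained, up to a meagre set, in an open set in which it is everywhere
non-meagre. -/
theorem exists_isOpen_isMeagre_diff {X : Type*} [TopologicalSpace X] [SecondCountableTopology X]
    (P : Set X) : ∃ E : Set X, IsOpen E ∧ IsMeagre (P \ E) ∧
      ∀ U ⊆ E, IsOpen U → IsMeagre (P ∩ U) → U = ∅ := by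
  let S := {U ∈ TopologicalSpace.countableBasis X | IsMeagre (P ∩ U)}
  have hSc : S.Countable := (TopologicalSpace.countable_countableBasis X).mono fun _ h ↦ h.1
  have hSo : IsOpen (⋃₀ S) :=
    isOpen_sUnion fun U hU ↦ TopologicalSpace.isOpen_of_mem_countableBasis hU.1
  have hSm : IsMeagre (P ∩ ⋃₀ S) := by
    have := hSc.to_subtype
    rw [sUnion_eq_iUnion, inter_iUnion]
    exact isMeagre_iUnion fun U ↦ U.2.2
  refine ⟨(closure (⋃₀ S))ᶜ, isClosed_closure.isOpen_compl, ?_, fun U hUE hU hUm ↦ ?_⟩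
  · refine (hSm.union hSo.isMeagre_closure_diff).mono fun x hx ↦ ?_
    by_cases h : x ∈ ⋃₀ S
    · exact .inl ⟨hx.1, h⟩
    · exact .inr ⟨by simpa using hx.2, h⟩
  · by_contra! hne
    obtain ⟨x, hx⟩ := hne
    obtain ⟨V, hV, hxV, hVU⟩ :=
      (TopologicalSpace.isBasis_countableBasis X).exists_subset_of_mem_open hx hU
    exact hUE hx (subset_closure ⟨V, ⟨hV, hUm.mono (by gcongr)⟩, hxV⟩)

/-- A non-meagre continuous image of a Polish space (that is, a non-meagre analytic set) is
co-meagre in some nonempty open set. -/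
theorem exists_isOpen_isMeagre_diff_range {Z X : Type*} [TopologicalSpace Z] [PolishSpace Z]
    [TopologicalSpace X] [SecondCountableTopology X] [T2Space X] {f : Z → X} (hf : Continuous f)
    (hne : ¬ IsMeagre (range f)) :
    ∃ U : Set X, IsOpen U ∧ U.Nonempty ∧ IsMeagre (U \ range f) := by
  let := TopologicalSpace.upgradeIsCompletelyMetrizable Z
  choose E hEo hEm hE using exists_isOpen_isMeagre_diff (X := X)
  have hEcl (P : Set X) : E P ⊆ closure P := by
    rw [← sdiff_eq_empty]
    refine hE P _ sdiff_subset ((hEo P).sdiff isClosed_closure) ?_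
    have : P ∩ (E P \ closure P) = ∅ := by
      ext x; simp only [mem_inter_iff, Set.mem_sdiff, mem_empty_iff_false, iff_false]
      exact fun h ↦ h.2.2 (subset_closure h.1)
    rw [this]; exact IsMeagre.empty
  -- If countably many sets cover `P`, then their envelopes cover `E P` up to a meagre set.
  have key (P : Set X) (S : Set (Set Z)) (hS : S.Countable) (hP : P ⊆ ⋃ O ∈ S, f '' O) :
      IsMeagre (E P \ ⋃ O ∈ S, E (f '' O)) := by
    set W := ⋃ O ∈ S, E (f '' O) with hW
    have hWo : IsOpen W := isOpen_biUnion fun O _ ↦ hEo _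
    have hsub : E P ⊆ closure W := by
      rw [← sdiff_eq_empty]
      refine hE P _ sdiff_subset ((hEo P).sdiff isClosed_closure) ?_
      have := hS.to_subtype
      refine (isMeagre_iUnion fun O : S ↦ hEm (f '' O)).mono fun x hx ↦ ?_
      obtain ⟨O, hO, hxO⟩ := mem_iUnion₂.1 (hP hx.1)
      exact mem_iUnion.2 ⟨⟨O, hO⟩, hxO, fun h ↦
        hx.2.2 (subset_closure (mem_iUnion₂.2 ⟨O, hO, h⟩))⟩
    exact hWo.isMeagre_closure_diff.mono (sdiff_subset_sdiff_left hsub)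
  let B := TopologicalSpace.countableBasis Z
  have hBc : B.Countable := TopologicalSpace.countable_countableBasis Z
  let S (O : Set Z) (n : ℕ) : Set (Set Z) :=
    {O' ∈ B | O' ⊆ O ∧ ∃ z, O' ⊆ Metric.ball z ((1 / 2) ^ n)}
  have hScov (O : Set Z) (hO : IsOpen O) (n : ℕ) : f '' O ⊆ ⋃ O' ∈ S O n, f '' O' := by
    rintro _ ⟨z, hz, rfl⟩
    obtain ⟨V, hV, hzV, hVO⟩ :=
      (TopologicalSpace.isBasis_countableBasis Z).exists_subset_of_mem_open
        (⟨hz, Metric.mem_ball_self (by positivity)⟩ : z ∈ O ∩ Metric.ball z ((1 / 2) ^ n))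
        (hO.inter Metric.isOpen_ball)
    exact mem_iUnion₂.2 ⟨V, ⟨hV, hVO.trans inter_subset_left, z, hVO.trans inter_subset_right⟩,
      z, hzV, rfl⟩
  -- The exceptional meagre set, off which every envelope is covered by finer envelopes.
  let M : Set X := ⋃ O ∈ insert univ B, ⋃ n : ℕ, E (f '' O) \ ⋃ O' ∈ S O n, E (f '' O')
  have hM : IsMeagre M := by
    have := (hBc.insert univ).to_subtype
    rw [show M = ⋃ O : (insert univ B : Set (Set Z)), ⋃ n : ℕ,
      E (f '' O) \ ⋃ O' ∈ S O n, E (f '' O') from biUnion_eq_iUnion _ _]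
    refine isMeagre_iUnion fun O ↦ isMeagre_iUnion fun n ↦ ?_
    refine key _ _ (hBc.mono fun _ h ↦ h.1) (hScov _ ?_ n)
    rcases O.2 with h | h
    · rw [h]; exact isOpen_univ
    · exact TopologicalSpace.isOpen_of_mem_countableBasis h
  refine ⟨E (range f), hEo _, ?_, hM.mono ?_⟩
  · by_contra! h
    exact hne ((hEm (range f)).mono (by simp [h]))
  rintro x ⟨hxE, hxf⟩
  by_contra hxM
  apply hxf
  have step (O : {O // O ∈ insert univ B ∧ x ∈ E (f '' O)}) (n : ℕ) :
      ∃ O' : {O // O ∈ insert univ B ∧ x ∈ E (f '' O)}, O'.1 ⊆ O.1 ∧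
        ∃ z, O'.1 ⊆ Metric.ball z ((1 / 2) ^ n) := by
    by_contra! h
    refine hxM (mem_iUnion₂.2 ⟨O.1, O.2.1, mem_iUnion.2 ⟨n, O.2.2, fun hx ↦ ?_⟩⟩)
    obtain ⟨O', hO', hxO'⟩ := mem_iUnion₂.1 hx
    obtain ⟨z, hz⟩ := hO'.2.2
    exact h ⟨O', mem_insert_of_mem _ hO'.1, hxO'⟩ hO'.2.1 z hz
  choose next hnext hball using step
  let O : ℕ → {O // O ∈ insert univ B ∧ x ∈ E (f '' O)} := fun n ↦
    Nat.rec ⟨univ, mem_insert _ _, by rwa [image_univ]⟩ (fun n O ↦ next O n) n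
  have hanti : Antitone fun n ↦ (O n).1 := antitone_nat_of_succ_le fun n ↦ hnext (O n) n
  have hOne (n : ℕ) : (O n).1.Nonempty := by
    have := hEcl _ (O n).2.2
    exact image_nonempty.1 (closure_nonempty_iff.1 ⟨x, this⟩)
  choose z hz using hOne
  choose c hc using hball
  have hdist (n : ℕ) (w : Z) (hw : w ∈ (O (n + 1)).1) : dist w (c (O n) n) < (1 / 2) ^ n :=
    hc (O n) n hw
  have hcau : CauchySeq fun n ↦ z (n + 1) := by
    refine cauchySeq_of_le_geometric (1 / 2) 2 (by norm_num) fun n ↦ ?_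
    have h1 := hdist n _ (hz (n + 1))
    have h2 := hdist n _ (hanti (Nat.le_succ (n + 1)) (hz (n + 2)))
    have := dist_triangle_right (z (n + 1)) (z (n + 2)) (c (O n) n)
    simp only [Nat.add_assoc, Nat.reduceAdd]
    linarith
  obtain ⟨w, hw⟩ := cauchySeq_tendsto_of_complete hcau
  refine ⟨w, ?_⟩
  by_contra hne
  obtain ⟨U, V, hU, hV, hwU, hxV, hUV⟩ := t2_separation hne
  obtain ⟨r, hr, hrU⟩ := Metric.isOpen_iff.1 (hU.preimage hf) w hwU
  obtain ⟨n, hn1, hn2⟩ := ((hw.eventually (Metric.ball_mem_nhds w (half_pos hr))).and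
    ((tendsto_pow_atTop_nhds_zero_of_lt_one (r := (1 / 2 : ℝ)) (by norm_num)
      (by norm_num)).eventually (gt_mem_nhds (by positivity : (0 : ℝ) < r / 4)))).exists
  obtain ⟨_, hyV, y, hy, rfl⟩ := mem_closure_iff.1 (hEcl _ (O (n + 1)).2.2) V hV hxV
  refine hUV.ne_of_mem (hrU ?_ : f y ∈ U) hyV rfl
  have h1 := hdist n _ hy
  have h2 := hdist n _ (hz (n + 1))
  have h3 := dist_triangle_right y (z (n + 1)) (c (O n) n)
  have h4 := dist_triangle y (z (n + 1)) w
  have h5 : dist (z (n + 1)) w < r / 2 := hn1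
  rw [Metric.mem_ball]
  linarith

/-! ### Generic tuples -/

theorem tendsto_conj_residual {G : Type*} [Group G] [TopologicalSpace G] [IsTopologicalGroup G]
    (g : G) : Tendsto (fun y ↦ g * y * g⁻¹) (residual G) (residual G) :=
  let e := (Homeomorph.mulLeft g).trans (Homeomorph.mulRight g⁻¹)
  tendsto_residual_of_isOpenMap e.continuous e.isOpenMap

/-- The tuple `x` is generic for the distance `d` if all the (closed) enlargements of its diagonal
conjugacy class are co-meagre. -/
def IsGenericTuple {G : Type*} [Group G] [TopologicalSpace G] (d : G → G → ℝ) {n : ℕ}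
    (x : Fin n → G) : Prop :=
  ∀ ε : ℝ, 0 < ε → {z : Fin n → G | ∃ g : G, ∀ i, d (z i) (g * x i * g⁻¹) ≤ ε} ∈ residual _

theorem HasAmpleGenerics.exists_mem_residual {G : Type*} [Group G] [TopologicalSpace G]
    {d : G → G → ℝ} (hG : HasAmpleGenerics d) (n : ℕ) {ε : ℝ} (hε : 0 < ε) :
    ∃ x : Fin n → G, {z : Fin n → G | ∃ g : G, ∀ i, d (z i) (g * x i * g⁻¹) ≤ ε} ∈ residual _ := by
  obtain ⟨x, hx⟩ := hG n ε hε
  refine ⟨x, mem_of_superset hx ?_⟩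
  rintro z ⟨_, ⟨g, rfl⟩, hz⟩
  exact ⟨ConjAct.ofConjAct g, fun i ↦
    (le_ciSup (f := fun j ↦ d (z j) (ConjAct.ofConjAct g * x j * (ConjAct.ofConjAct g)⁻¹))
      (Set.finite_range _).bddAbove i).trans hz.le⟩

theorem isGenericTuple_iff_nat {G : Type*} [Group G] [TopologicalSpace G] {d : G → G → ℝ} {n : ℕ}
    {x : Fin n → G} : IsGenericTuple d x ↔ ∀ k : ℕ,
      {z : Fin n → G | ∃ g : G, ∀ i, d (z i) (g * x i * g⁻¹) ≤ 1 / (k + 1 : ℝ)} ∈ residual _ := by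
  refine ⟨fun h k ↦ h _ (by positivity), fun h ε hε ↦ ?_⟩
  obtain ⟨k, hk⟩ := exists_nat_one_div_lt hε
  filter_upwards [h k] with z ⟨g, hg⟩
  exact ⟨g, fun i ↦ (hg i).trans hk.le⟩

namespace IsTopometricGroup

variable {G : Type*} [Group G] [TopologicalSpace G] [IsTopologicalGroup G] {d : G → G → ℝ}

theorem dist_comm (hd : IsTopometricGroup d) (x y : G) : d x y = d y x :=
  hd.isTopometricSpace.dist_comm x y

theorem dist_triangle (hd : IsTopometricGroup d) (x y z : G) : d x z ≤ d x y + d y z :=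
  hd.isTopometricSpace.dist_triangle x y z

theorem dist_conj (hd : IsTopometricGroup d) (g x y : G) :
    d (g * x * g⁻¹) (g * y * g⁻¹) = d x y := by
  rw [hd.dist_mul_right, hd.dist_mul_left]

theorem dist_conj_mul (hd : IsTopometricGroup d) (g h x y : G) :
    d (g * x * g⁻¹) ((g * h) * y * (g * h)⁻¹) = d x (h * y * h⁻¹) := by
  rw [← hd.dist_conj g x]; group

theorem dist_inv_mul_conj (hd : IsTopometricGroup d) (g h x y : G) :
    d ((g⁻¹ * h) * x * (g⁻¹ * h)⁻¹) y = d (h * x * h⁻¹) (g * y * g⁻¹) := by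
  rw [← hd.dist_conj g _ y]; group

theorem dist_mul_inv_le (hd : IsTopometricGroup d) (x y a b : G) :
    d (x * y⁻¹) (a * b⁻¹) ≤ d x a + d y b := by
  have h1 : d (x * y⁻¹) (a * y⁻¹) = d x a := hd.dist_mul_right _ _ _
  have h2 : d (a * y⁻¹) (a * b⁻¹) = d y b := by
    rw [hd.dist_mul_left, ← hd.dist_mul_left y, ← hd.dist_mul_right b, hd.dist_comm]
    group
  have := hd.dist_triangle (x * y⁻¹) (a * y⁻¹) (a * b⁻¹)
  linarith

/-- Ample generics give a co-meagre set of generic tuples: if the `ε / 2`-enlargement of the class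
of `z` is co-meagre, it is contained in the `ε`-enlargement of the class of each of its members. -/
theorem eventually_isGenericTuple (hd : IsTopometricGroup d) (hG : HasAmpleGenerics d) (n : ℕ) :
    ∀ᶠ x in residual (Fin n → G), IsGenericTuple d x := by
  simp_rw [isGenericTuple_iff_nat]
  refine eventually_countable_forall.2 fun k ↦ ?_
  obtain ⟨z, hz⟩ := hG.exists_mem_residual n (ε := 1 / (k + 1 : ℝ) / 2) (by positivity)
  filter_upwards [hz] with x ⟨g, hg⟩
  filter_upwards [hz] with w ⟨h, hh⟩
  refine ⟨h * g⁻¹, fun i ↦ ?_⟩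
  have h1 := hd.dist_triangle (w i) (h * z i * h⁻¹) ((h * g⁻¹) * x i * (h * g⁻¹)⁻¹)
  rw [hd.dist_conj_mul h, hd.dist_comm (z i), show g⁻¹ = g⁻¹ * 1 by simp,
    hd.dist_inv_mul_conj] at h1
  have h2 := hg i
  have h3 := hh i
  simp only [mul_one, one_mul, inv_one] at h1 ⊢
  linarith

variable [PolishSpace G]

/-- A generic tuple extends to a generic tuple by almost any element. A Kuratowski–Ulam argument
gives this for almost every tuple; genericity of `x` transfers it from a tuple `x'` close to a
conjugate of `x`. -/
theorem eventually_isGenericTuple_cons (hd : IsTopometricGroup d) (hG : HasAmpleGenerics d) {n : ℕ}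
    {x : Fin n → G} (hx : IsGenericTuple d x) :
    ∀ᶠ y in residual G, IsGenericTuple d (Fin.cons y x : Fin (n + 1) → G) := by
  simp_rw [isGenericTuple_iff_nat]
  refine eventually_countable_forall.2 fun k ↦ ?_
  set ε : ℝ := 1 / (k + 1 : ℝ) with hε
  have hε0 : 0 < ε := by positivity
  obtain ⟨x', hx', g, hg⟩ := ((eventually_residual_finCons
    (hd.eventually_isGenericTuple hG (n + 1))).and (hx (ε / 2) (half_pos hε0))).exists
  filter_upwards [tendsto_conj_residual g hx'] with y hy
  filter_upwards [hy (ε / 2) (half_pos hε0)] with w ⟨h, hh⟩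
  refine ⟨h * g, fun i ↦ ?_⟩
  refine Fin.cases ?_ (fun i ↦ ?_) i
  · have := hh 0
    simp only [Fin.cons_zero] at this ⊢
    rw [show h * g * y * (h * g)⁻¹ = h * (g * y * g⁻¹) * h⁻¹ by group]
    linarith
  · have h1 := hh i.succ
    have h2 := hg i
    simp only [Fin.cons_succ] at h1 ⊢
    have h3 := hd.dist_triangle (w i.succ) (h * x' i * h⁻¹) ((h * g) * x i * (h * g)⁻¹)
    rw [hd.dist_conj_mul] at h3
    linarith

/-- If `(y, x)` is generic, then the elements that almost fix `x` move `y` close to almost every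
element of the group. -/
theorem eventually_exists_conj_le (hd : IsTopometricGroup d) {n : ℕ} {x : Fin n → G} {y : G}
    (hxy : IsGenericTuple d (Fin.cons y x : Fin (n + 1) → G)) {ε : ℝ} (hε : 0 < ε) :
    ∀ᶠ y' in residual G, ∃ h : G, (∀ i, d (h * x i * h⁻¹) (x i) ≤ ε) ∧ d (h * y * h⁻¹) y' ≤ ε := by
  obtain ⟨x', hx'⟩ := (eventually_residual_finCons (hxy (ε / 2) (half_pos hε))).exists
  obtain ⟨_, g₀, hg₀⟩ := hx'.exists
  filter_upwards [tendsto_conj_residual g₀ hx'] with y' ⟨g, hg⟩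
  refine ⟨g₀⁻¹ * g, fun i ↦ ?_, ?_⟩
  · have h1 := hg i.succ
    have h2 := hg₀ i.succ
    simp only [Fin.cons_succ] at h1 h2
    rw [hd.dist_inv_mul_conj]
    have := hd.dist_triangle (g * x i * g⁻¹) (x' i) (g₀ * x i * g₀⁻¹)
    rw [hd.dist_comm _ (x' i)] at this
    linarith
  · have h1 := hg 0
    simp only [Fin.cons_zero] at h1
    rw [hd.dist_inv_mul_conj, hd.dist_comm]
    linarith

/-- The set of elements approached in `eventually_exists_conj_le` stays non-meagre when the
conjugating elements are taken close to the identity: countably many translates of a neighbourhood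
of `1` cover the group. -/
theorem not_isMeagre_conj_le (hd : IsTopometricGroup d) {n : ℕ} {x : Fin n → G} {y : G}
    (hxy : IsGenericTuple d (Fin.cons y x : Fin (n + 1) → G)) {ε : ℝ} (hε : 0 < ε) {W : Set G}
    (hW : W ∈ 𝓝 (1 : G)) :
    ¬ IsMeagre {y' : G | ∃ h ∈ W, (∀ i, d (h * x i * h⁻¹) (x i) ≤ ε) ∧
      d (h * y * h⁻¹) y' ≤ ε} := by
  intro hm
  let S := {h : G | ∀ i, d (h * x i * h⁻¹) (x i) ≤ ε / 2}
  obtain ⟨t, htS, htc, ht⟩ := TopologicalSpace.countable_cover_nhdsWithin (s := S)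
    (f := fun s ↦ (fun h ↦ s⁻¹ * h) ⁻¹' W) fun s _ ↦ mem_nhdsWithin_of_mem_nhds
      (ContinuousAt.preimage_mem_nhds (by fun_prop) (by simpa using hW))
  have hbad : ∀ᶠ y' in residual G, ∀ s ∈ t, ¬ ∃ h ∈ W, (∀ i, d (h * x i * h⁻¹) (x i) ≤ ε) ∧
      d (h * y * h⁻¹) (s⁻¹ * y' * s⁻¹⁻¹) ≤ ε :=
    (eventually_countable_ball htc).2 fun s _ ↦ tendsto_conj_residual s⁻¹ hm
  obtain ⟨y', hy', h, hhS, hhy⟩ :=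
    (hbad.and (hd.eventually_exists_conj_le hxy (half_pos hε))).exists
  obtain ⟨s, hs, hsW⟩ := mem_iUnion₂.1 (ht hhS)
  refine hy' s hs ⟨s⁻¹ * h, hsW, fun i ↦ ?_, ?_⟩
  · rw [hd.dist_inv_mul_conj]
    have h1 := hhS i
    have h2 := htS hs i
    have h3 := hd.dist_triangle (h * x i * h⁻¹) (x i) (s * x i * s⁻¹)
    rw [hd.dist_comm (x i) (s * x i * s⁻¹)] at h3
    linarith
  · rw [hd.dist_inv_mul_conj, show s * (s⁻¹ * y' * s⁻¹⁻¹) * s⁻¹ = y' by group]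
    linarith

/-- The conjugates of `y` by elements of `W` that almost fix `x` come close to almost every element
of some nonempty open set. -/
theorem exists_isOpen_isMeagre_diff_conj_le (hd : IsTopometricGroup d) {n : ℕ} {x : Fin n → G}
    {y : G} (hxy : IsGenericTuple d (Fin.cons y x : Fin (n + 1) → G)) {ε : ℝ} (hε : 0 < ε)
    {W : Set G} (hW : W ∈ 𝓝 (1 : G)) :
    ∃ U : Set G, IsOpen U ∧ U.Nonempty ∧ IsMeagre (U \ {y' : G | ∃ h ∈ W,
      (∀ i, d (h * x i * h⁻¹) (x i) ≤ ε) ∧ d (h * y * h⁻¹) y' ≤ ε}) := by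
  obtain ⟨W', hW', hW'c, hWW'⟩ := exists_mem_nhds_isClosed_subset hW
  let F := {p : G × G | p.1 ∈ W' ∧
    (∀ i, d (p.1 * x i * p.1⁻¹) (x i) ≤ ε) ∧ d (p.1 * y * p.1⁻¹) p.2 ≤ ε}
  have hcl {f f' : G × G → G} (hf : Continuous f) (hf' : Continuous f') :
      IsClosed {p | d (f p) (f' p) ≤ ε} :=
    (hd.isTopometricSpace.isClosed_le ε).preimage (hf.prodMk hf')
  have hF : IsClosed F := by
    refine (hW'c.preimage continuous_fst).inter (IsClosed.inter ?_ ?_)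
    · rw [show (fun p : G × G ↦ ∀ i, d (p.1 * x i * p.1⁻¹) (x i) ≤ ε) =
        ⋂ i, {p : G × G | d (p.1 * x i * p.1⁻¹) (x i) ≤ ε} from (iInter_ofPred _).symm]
      exact isClosed_iInter fun i ↦ hcl (by fun_prop) (by fun_prop)
    · exact hcl (by fun_prop) (by fun_prop)
  have := hF.polishSpace
  have hrange : range (fun p : F ↦ p.1.2) = {y' : G | ∃ h ∈ W',
      (∀ i, d (h * x i * h⁻¹) (x i) ≤ ε) ∧ d (h * y * h⁻¹) y' ≤ ε} := by
    ext y'; simp [F]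
  obtain ⟨U, hU, hUne, hUm⟩ := exists_isOpen_isMeagre_diff_range
    (f := fun p : F ↦ p.1.2) (by fun_prop) (hrange ▸ hd.not_isMeagre_conj_le hxy hε hW')
  refine ⟨U, hU, hUne, hUm.mono ?_⟩
  rw [hrange]
  exact sdiff_subset_sdiff_right fun y' ⟨h, hh, hy'⟩ ↦ ⟨h, hWW' hh, hy'⟩

/-- The extension step of the tree construction. The point `a` is any element of `A` that extends
`x` generically; as `B` is everywhere non-meagre, it meets the set of elements that are approached
by conjugates of `a` under `W`. -/
theorem exists_isGenericTuple_cons_conj_le (hd : IsTopometricGroup d) (hG : HasAmpleGenerics d)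
    {A B : Set G} (hA : ¬ IsMeagre A)
    (hB : ∀ U : Set G, IsOpen U → U.Nonempty → ¬ IsMeagre (U ∩ B))
    {n : ℕ} {x : Fin n → G} (hx : IsGenericTuple d x) {ε : ℝ} (hε : 0 < ε) {W : Set G}
    (hW : W ∈ 𝓝 (1 : G)) :
    ∃ a ∈ A, ∃ b ∈ B, ∃ f ∈ W, IsGenericTuple d (Fin.cons a x : Fin (n + 1) → G) ∧
      IsGenericTuple d (Fin.cons b x : Fin (n + 1) → G) ∧
      (∀ i, d (f * x i * f⁻¹) (x i) ≤ ε) ∧ d (f * a * f⁻¹) b ≤ ε := by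
  have hT := hd.eventually_isGenericTuple_cons hG hx
  obtain ⟨a, haA, ha⟩ : ∃ a ∈ A, IsGenericTuple d (Fin.cons a x : Fin (n + 1) → G) := by
    by_contra! h
    exact hA (mem_of_superset hT fun y hy hyA ↦ h y hyA hy)
  obtain ⟨U, hU, hUne, hUm⟩ := hd.exists_isOpen_isMeagre_diff_conj_le ha hε hW
  by_contra! h
  refine hB U hU hUne ?_
  filter_upwards [hT, hUm] with b hb hbU hbUB
  refine hbU ⟨hbUB.1, fun ⟨f, hf, hfx, hfb⟩ ↦ ?_⟩
  exact (h a haA b hbUB.2 f hf ha hb hfx).not_ge hfb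

end IsTopometricGroup

/-! ### The tree construction -/

/-- A continuous family of elements `H a` of `G`, indexed by the Cantor space, such that
`H a • X n` and `H b • Y n` come close to each other whenever `a` and `b` split at `n`. Along a
branch `a`, a tuple and a group element `h` are built: at level `n`, the tuple gets a new entry from
`X n` or `Y n`, according to `a n`, and `h` is replaced by `h * f` or kept, where `f` is close
to `1`, moves the entry chosen in `X n` close to the one chosen in `Y n`, and almost fixes the
earlier entries. -/
theorem IsTopometricGroup.exists_continuous_tree {G : Type*} [Group G] [TopologicalSpace G]
    [IsTopologicalGroup G] [PolishSpace G] {d : G → G → ℝ} (hd : IsTopometricGroup d)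
    (hG : HasAmpleGenerics d) {X Y : ℕ → Set G} (hX : ∀ n, ¬ IsMeagre (X n))
    (hY : ∀ n (U : Set G), IsOpen U → U.Nonempty → ¬ IsMeagre (U ∩ Y n))
    {ε : ℕ → ℝ} (hε : ∀ n, 0 < ε n) (hε2 : ∀ n, ε (n + 1) ≤ ε n / 2) :
    ∃ H : (ℕ → Bool) → G, Continuous H ∧ ∀ a b n, (∀ i < n, a i = b i) → a n = false →
      b n = true → ∃ x ∈ X n, ∃ y ∈ Y n,
        d (H a * x * (H a)⁻¹) (H b * y * (H b)⁻¹) ≤ 3 * ε n := by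
  let := TopologicalSpace.upgradeIsCompletelyMetrizable G
  let State (n : ℕ) := {x : Fin n → G // IsGenericTuple d x} × G
  have step (n : ℕ) (s : State n) : ∃ x ∈ X n, ∃ y ∈ Y n, ∃ s' : Bool → State (n + 1),
      (∀ β, (s' β).1.1 = (Fin.cons (bif β then y else x) s.1.1 : Fin (n + 1) → G)) ∧
      (∀ β, dist s.2 (s' β).2 ≤ (1 / 2) ^ n) ∧
      (∀ β i, d ((s' β).2 * s.1.1 i * (s' β).2⁻¹) (s.2 * s.1.1 i * s.2⁻¹) ≤ ε n) ∧
      d ((s' false).2 * x * (s' false).2⁻¹) ((s' true).2 * y * (s' true).2⁻¹) ≤ ε n := by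
    obtain ⟨⟨z, hz⟩, h⟩ := s
    have hW : (fun f ↦ h * f) ⁻¹' Metric.ball h ((1 / 2) ^ n) ∈ 𝓝 (1 : G) :=
      ContinuousAt.preimage_mem_nhds (by fun_prop)
        (by simpa using Metric.ball_mem_nhds h (by positivity))
    obtain ⟨x, hx, y, hy, f, hf, hxz, hyz, hfz, hfxy⟩ :=
      hd.exists_isGenericTuple_cons_conj_le hG (hX n) (hY n) hz (hε n) hW
    refine ⟨x, hx, y, hy, fun β ↦ bif β then (⟨_, hyz⟩, h) else (⟨_, hxz⟩, h * f),
      ?_, ?_, ?_, ?_⟩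
    · rintro (_ | _) <;> rfl
    · rintro (_ | _)
      · exact (Metric.mem_ball'.1 hf).le
      · simp
    · rintro (_ | _) i
      · rw [hd.dist_comm]
        simp only [cond_false, hd.dist_conj_mul]
        rw [hd.dist_comm]
        exact hfz i
      · simpa [hd.isTopometricSpace.dist_self] using (hε n).le
    · rw [hd.dist_comm]
      simp only [cond_false, cond_true, hd.dist_conj_mul]
      rwa [hd.dist_comm]
  choose x hx y hy next hcons hdist hfix hxy using step
  obtain ⟨s₀, -⟩ := (hd.eventually_isGenericTuple hG 0).exists
  have hs₀ : IsGenericTuple d s₀ := by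
    obtain ⟨z, hz⟩ := (hd.eventually_isGenericTuple hG 0).exists
    rwa [Subsingleton.elim s₀ z]
  let state (a : ℕ → Bool) (n : ℕ) : State n :=
    Nat.rec (⟨s₀, hs₀⟩, 1) (fun n s ↦ next n s (a n)) n
  have hstate (a b : ℕ → Bool) (n : ℕ) (hab : ∀ i < n, a i = b i) : state a n = state b n := by
    induction n with
    | zero => rfl
    | succ n ih =>
      change next n (state a n) (a n) = next n (state b n) (b n)
      rw [ih fun i hi ↦ hab i (hi.trans n.lt_succ_self), hab n n.lt_succ_self]
  have hd' (a : ℕ → Bool) (n : ℕ) : dist (state a n).2 (state a (n + 1)).2 ≤ 2 / 2 / 2 ^ n := by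
    have := hdist n (state a n) (a n)
    simpa using this
  have hlim (a : ℕ → Bool) : ∃ g, Tendsto (fun n ↦ (state a n).2) atTop (𝓝 g) :=
    cauchySeq_tendsto_of_complete (cauchySeq_of_le_geometric_two (hd' a))
  choose H hH using hlim
  have hHd (a : ℕ → Bool) (n : ℕ) : dist (state a n).2 (H a) ≤ 2 / 2 ^ n :=
    dist_le_of_le_geometric_two_of_tendsto (hd' a) (hH a) n
  refine ⟨H, ?_, ?_⟩
  · -- `H` is a uniform limit of locally constant functions.
    have hunif : TendstoUniformly (fun n a ↦ (state a n).2) H atTop := by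
      refine Metric.tendstoUniformly_iff.2 fun r hr ↦ ?_
      have h0 : Tendsto (fun n : ℕ ↦ (2 : ℝ) / 2 ^ n) atTop (𝓝 0) :=
        tendsto_const_nhds.div_atTop (tendsto_pow_atTop_atTop_of_one_lt one_lt_two)
      filter_upwards [h0.eventually (gt_mem_nhds hr)] with n hn a
      rw [_root_.dist_comm]
      exact (hHd a n).trans_lt hn
    refine hunif.continuous (Frequently.of_forall fun n ↦ ?_)
    refine IsLocallyConstant.continuous ((IsLocallyConstant.iff_exists_open _).2 fun a ↦
      ⟨(Set.Iio n).pi fun i ↦ {a i}, isOpen_set_pi (finite_Iio n) fun _ _ ↦ isOpen_discrete _,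
        fun i _ ↦ rfl, fun b hb ↦ ?_⟩)
    rw [hstate b a n fun i hi ↦ hb i hi]
  · -- Once `z` is an entry of the tuple, the later group elements move it along almost equally.
    have htail (a : ℕ → Bool) (n : ℕ) (z : G) (hz : z ∈ range (state a (n + 1)).1.1) :
        d (H a * z * (H a)⁻¹) ((state a (n + 1)).2 * z * (state a (n + 1)).2⁻¹) ≤ ε n := by
      -- As `ε m ≤ 2 * (ε m - ε (m + 1))`, the errors `ε m` of the single steps telescope.
      have hfin (m : ℕ) (hm : n + 1 ≤ m) : z ∈ range (state a m).1.1 ∧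
          d ((state a m).2 * z * (state a m).2⁻¹)
            ((state a (n + 1)).2 * z * (state a (n + 1)).2⁻¹) ≤ 2 * (ε (n + 1) - ε m) := by
        induction m, hm using Nat.le_induction with
        | base => exact ⟨hz, by simp [hd.isTopometricSpace.dist_self]⟩
        | succ m hm ih =>
          obtain ⟨⟨i, hi⟩, ih⟩ := ih
          refine ⟨⟨i.succ, ?_⟩, ?_⟩
          · change (next m (state a m) (a m)).1.1 i.succ = z
            rw [hcons, Fin.cons_succ, hi]
          · have h1 := hfix m (state a m) (a m) i
            rw [hi] at h1
            have h2 := hd.dist_triangle ((state a (m + 1)).2 * z * (state a (m + 1)).2⁻¹)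
              ((state a m).2 * z * (state a m).2⁻¹)
              ((state a (n + 1)).2 * z * (state a (n + 1)).2⁻¹)
            have h3 := hε2 m
            have h4 : d ((state a (m + 1)).2 * z * (state a (m + 1)).2⁻¹)
              ((state a m).2 * z * (state a m).2⁻¹) ≤ ε m := h1
            linarith
      have hlim : Tendsto (fun m ↦ ((state a m).2 * z * (state a m).2⁻¹,
          (state a (n + 1)).2 * z * (state a (n + 1)).2⁻¹)) atTop
          (𝓝 (H a * z * (H a)⁻¹, (state a (n + 1)).2 * z * (state a (n + 1)).2⁻¹)) :=
        (((hH a).mul_const z).mul (hH a).inv).prodMk_nhds tendsto_const_nhds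
      refine (hd.isTopometricSpace.isClosed_le (ε n)).mem_of_tendsto hlim ?_
      filter_upwards [eventually_ge_atTop (n + 1)] with m hm
      have h1 := (hfin m hm).2
      have h2 := hε2 n
      have h3 := hε m
      change d _ _ ≤ ε n
      linarith
    intro a b n hab ha hb
    have hab' := hstate a b n hab
    have ha' : state a (n + 1) = next n (state a n) false := by rw [← ha]
    have hb' : state b (n + 1) = next n (state a n) true := by rw [← hb, hab']
    refine ⟨_, hx n (state a n), _, hy n (state a n), ?_⟩
    have h1 := htail a n (x n (state a n)) ⟨0, by rw [ha', hcons]; rfl⟩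
    have h2 := htail b n (y n (state a n)) ⟨0, by rw [hb', hcons]; rfl⟩
    have h3 := hxy n (state a n)
    rw [ha'] at h1
    rw [hb', hd.dist_comm] at h2
    have htri {p q r s : G} (h1 : d p q ≤ ε n) (h2 : d q r ≤ ε n) (h3 : d r s ≤ ε n) :
        d p s ≤ 3 * ε n := by
      linarith [hd.dist_triangle p q s, hd.dist_triangle q r s]
    exact htri h1 h3 h2

/-! ### Covering a co-meagre set by translates -/

/-- Pettis' theorem. -/
theorem mul_inv_mem_nhds_one_of_isMeagre_diff {G : Type*} [Group G] [TopologicalSpace G]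
    [IsTopologicalGroup G] [BaireSpace G] {U P : Set G} (hU : IsOpen U) (hne : U.Nonempty)
    (hP : IsMeagre (U \ P)) : P * P⁻¹ ∈ 𝓝 (1 : G) := by
  obtain ⟨u, hu⟩ := hne
  have h1 : (1 : G) ∈ U * U⁻¹ := ⟨u, hu, u⁻¹, by simpa using hu, by simp⟩
  refine mem_of_superset (hU.mul_right.mem_nhds h1) ?_
  rintro _ ⟨v, hv, w, hw, rfl⟩
  set g := v * w with hg
  have hP' : IsMeagre ((fun x ↦ g⁻¹ * x) ⁻¹' (U \ P)) :=
    hP.preimage_of_isOpenMap (continuous_const_mul _) (isOpenMap_mul_left _)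
  obtain ⟨x, ⟨hxU, hgx⟩, hx⟩ : ((U ∩ (fun x ↦ g⁻¹ * x) ⁻¹' U) \
      ((U \ P) ∪ (fun x ↦ g⁻¹ * x) ⁻¹' (U \ P))).Nonempty := by
    by_contra! h
    refine not_isMeagre_of_isOpen (hU.inter (hU.preimage (continuous_const_mul g⁻¹)))
      ⟨v, hv, by simpa [hg] using hw⟩ ((hP.union hP').mono (sdiff_eq_empty.1 h))
  simp only [mem_union, Set.mem_sdiff, mem_preimage, not_or, not_and, not_not] at hx
  exact ⟨x, hx.1 hxU, x⁻¹ * g, by simpa using hx.2 hgx, mul_inv_cancel_left x g⟩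

theorem IsTopometricGroup.enlargement_mul_inv_subset {G : Type*} [Group G] [TopologicalSpace G]
    [IsTopologicalGroup G] {d : G → G → ℝ} (hd : IsTopometricGroup d) (D : Set G) (ε : ℝ) :
    enlargement d D (ε / 2) * (enlargement d D (ε / 2))⁻¹ ⊆ enlargement d (D * D⁻¹) ε := by
  rintro _ ⟨p, ⟨a, ha, hpa⟩, q, ⟨b, hb, hqb⟩, rfl⟩
  refine ⟨a * b⁻¹, mul_mem_mul ha (inv_mem_inv.2 hb), ?_⟩
  have := hd.dist_mul_inv_le p q⁻¹ a b
  rw [inv_inv] at this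
  change d (p * q) _ < ε
  linarith

theorem exists_pos_le_half_lt (δ : ℕ → ℝ) (hδ : ∀ n, 0 < δ n) :
    ∃ ε : ℕ → ℝ, (∀ n, 0 < ε n) ∧ (∀ n, ε (n + 1) ≤ ε n / 2) ∧ ∀ n, 3 * ε n < δ n := by
  let ε : ℕ → ℝ := fun n ↦ Nat.rec (δ 0 / 4) (fun n e ↦ min (e / 2) (δ (n + 1) / 4)) n
  have hsucc (n : ℕ) : ε (n + 1) = min (ε n / 2) (δ (n + 1) / 4) := rfl
  have hle (n : ℕ) : ε n ≤ δ n / 4 := by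
    cases n with
    | zero => exact le_rfl
    | succ n => exact min_le_right _ _
  refine ⟨ε, fun n ↦ ?_, fun n ↦ min_le_left _ _, fun n ↦ ?_⟩
  · induction n with
    | zero => exact div_pos (hδ 0) (by norm_num)
    | succ n ih => rw [hsucc]; exact lt_min (half_pos ih) (div_pos (hδ _) (by norm_num))
  · linarith [hle n, hδ n]

theorem exists_cylinder_subset_closure {T : Set (ℕ → Bool)} (hT : ¬ IsMeagre T) :
    ∃ (c : ℕ → Bool) (N : ℕ), PiNat.cylinder c N ⊆ closure T := by
  have h : (interior (closure T)).Nonempty := by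
    by_contra! h
    exact hT (IsNowhereDense.isMeagre h)
  obtain ⟨c, hc⟩ := h
  obtain ⟨_, ⟨b, N, rfl⟩, -, hN⟩ :=
    (PiNat.isTopologicalBasis_cylinders _).exists_subset_of_mem_open hc isOpen_interior
  exact ⟨b, N, hN.trans interior_subset⟩

/-- Every co-meagre set contains almost all members of some translate of a continuous family: for
each fixed `a`, almost every `g` satisfies `g * H a ∈ C`, and Kuratowski–Ulam swaps the two
quantifiers. -/
theorem exists_eventually_mul_mem {G K : Type*} [Group G] [TopologicalSpace G]
    [IsTopologicalGroup G] [BaireSpace G] [TopologicalSpace K] [SecondCountableTopology K]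
    {H : K → G} (hH : Continuous H) {C : Set G} (hC : C ∈ residual G) :
    ∃ g : G, ∀ᶠ a in residual K, g * H a ∈ C := by
  let e : G × K ≃ₜ G × K :=
    { toFun := fun p ↦ (p.1 * H p.2, p.2)
      invFun := fun p ↦ (p.1 * (H p.2)⁻¹, p.2)
      left_inv := fun p ↦ by simp
      right_inv := fun p ↦ by simp
      continuous_toFun := by fun_prop
      continuous_invFun := by fun_prop }
  exact (eventually_residual_prod (tendsto_residual_of_isOpenMap (continuous_fst.comp e.continuous)
    (isOpenMap_fst.comp e.isOpenMap) hC)).exists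

theorem mainTheorem4 {G : Type*} [Group G] [TopologicalSpace G] [IsTopologicalGroup G]
    [PolishSpace G] (d : G → G → ℝ) (hd : IsTopometricGroup d) (hG : HasAmpleGenerics d)
    (k : ℕ → G) (A : ℕ → Set G) (hA : (⋃ n, k n • A n) ∈ residual G) :
    ∃ n, ∀ ε : ℝ, 0 < ε →
      (1 : G) ∈ interior (enlargement d
        ((A n)⁻¹ * A n * (A n)⁻¹ * (A n)⁻¹ * A n * (A n)⁻¹ * A n * A n * (A n)⁻¹ * A n) ε) := by
  by_contra! hcon
  choose δ hδ hint using hcon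
  let D (n : ℕ) : Set G := (A n)⁻¹ * A n * (A n)⁻¹ * (A n)⁻¹ * A n
  have hD (n : ℕ) : (A n)⁻¹ * A n * (A n)⁻¹ * (A n)⁻¹ * A n * (A n)⁻¹ * A n * A n * (A n)⁻¹ * A n
      = D n * (D n)⁻¹ := by
    simp only [D, mul_inv_rev, inv_inv, mul_assoc]
  have hY (n : ℕ) (U : Set G) (hU : IsOpen U) (hne : U.Nonempty) :
      ¬ IsMeagre (U ∩ (enlargement d (D n) (δ n / 2))ᶜ) := fun hm ↦ by
    refine hint n (mem_interior_iff_mem_nhds.2 ?_)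
    rw [hD]
    exact mem_of_superset (mul_inv_mem_nhds_one_of_isMeagre_diff hU hne hm)
      (hd.enlargement_mul_inv_subset _ _)
  have hcov : {g | ∃ n, ¬ IsMeagre (A n) ∧ (k n)⁻¹ * g ∈ A n} ∈ residual G := by
    have h : ∀ᶠ g in residual G, ∀ n, IsMeagre (A n) → (k n)⁻¹ * g ∉ A n :=
      eventually_countable_forall.2 fun n ↦ by
        by_cases hn : IsMeagre (A n)
        · filter_upwards [hn.preimage_of_isOpenMap (continuous_const_mul (k n)⁻¹)
            (isOpenMap_mul_left _)] with g hg _ using hg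
        · simp [hn]
    filter_upwards [hA, h] with g hg hgn
    obtain ⟨n, hn⟩ := mem_iUnion.1 hg
    have hn' : (k n)⁻¹ * g ∈ A n := mem_smul_set_iff_inv_smul_mem.1 hn
    exact ⟨n, fun hm ↦ hgn n hm hn', hn'⟩
  -- In the tree construction every index has to be handled at arbitrarily high levels. When `A n`
  -- is meagre, `X` is the whole group at the levels of `n`, which are then irrelevant.
  let X (m : ℕ) : Set G := {x | IsMeagre (A m.unpair.1) ∨ x⁻¹ ∈ A m.unpair.1}
  have hX (m : ℕ) : ¬ IsMeagre (X m) := fun hm ↦ by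
    by_cases hn : IsMeagre (A m.unpair.1)
    · exact not_isMeagre_of_isOpen isOpen_univ univ_nonempty (hm.mono fun x _ ↦ .inl hn)
    · refine hn ((hm.preimage_of_isOpenMap continuous_inv (Homeomorph.inv G).isOpenMap).mono ?_)
      exact fun x hx ↦ .inr (by simpa using hx)
  obtain ⟨ε, hε, hε2, hεδ⟩ := exists_pos_le_half_lt (fun m ↦ δ m.unpair.1 / 2)
    fun m ↦ half_pos (hδ _)
  obtain ⟨H, hHc, hH⟩ := hd.exists_continuous_tree hG hX (fun m ↦ hY m.unpair.1) hε hε2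
  obtain ⟨g, hg⟩ := exists_eventually_mul_mem hHc hcov
  obtain ⟨n, hn⟩ : ∃ n, ¬ IsMeagre {a | ¬ IsMeagre (A n) ∧ (k n)⁻¹ * (g * H a) ∈ A n} := by
    by_contra! h
    obtain ⟨a, ⟨n, hn⟩, ha⟩ := (hg.and (eventually_countable_forall.2 h)).exists
    exact ha n hn
  obtain ⟨c, N, hcN⟩ := exists_cylinder_subset_closure hn
  set m := Nat.pair n N with hm
  have hmn : m.unpair.1 = n := by simp [hm]
  have hbranch (β : Bool) : ∃ a ∈ PiNat.cylinder c m, a m = β ∧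
      ¬ IsMeagre (A n) ∧ (k n)⁻¹ * (g * H a) ∈ A n := by
    obtain ⟨a, ha, haT⟩ := mem_closure_iff.1
      (hcN (PiNat.cylinder_anti c (Nat.right_le_pair n N) (PiNat.update_mem_cylinder c m β)))
      (PiNat.cylinder (Function.update c m β) (m + 1)) (PiNat.isOpen_cylinder _ _ _)
      (PiNat.self_mem_cylinder _ _)
    refine ⟨a, fun i hi ↦ ?_, ?_, haT⟩
    · rw [ha i (hi.trans m.lt_succ_self), Function.update_of_ne hi.ne]
    · rw [ha m m.lt_succ_self, Function.update_self]
  obtain ⟨a, hac, ham, hAn, ha⟩ := hbranch false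
  obtain ⟨b, hbc, hbm, -, hb⟩ := hbranch true
  obtain ⟨x, hx, y, hy, hxy⟩ := hH a b m (fun i hi ↦ (hac i hi).trans (hbc i hi).symm) ham hbm
  have hx' : x⁻¹ ∈ A n := by
    have := hx.resolve_left (by rwa [hmn])
    rwa [hmn] at this
  -- `(H b)⁻¹ * H a ∈ (A n)⁻¹ * A n`, so that it conjugates `x` into `D n`.
  refine hy ⟨((H b)⁻¹ * H a) * x * ((H b)⁻¹ * H a)⁻¹, ?_, ?_⟩
  · rw [hmn]
    have hmem : ((k n)⁻¹ * (g * H b))⁻¹ * ((k n)⁻¹ * (g * H a)) * x *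
        (((k n)⁻¹ * (g * H a))⁻¹) * ((k n)⁻¹ * (g * H b)) ∈ D n :=
      mul_mem_mul (mul_mem_mul (mul_mem_mul (mul_mem_mul (inv_mem_inv.2 hb) ha)
        (by simpa using hx')) (inv_mem_inv.2 ha)) hb
    convert hmem using 1
    group
  · rw [hd.dist_comm, hd.dist_inv_mul_conj]
    exact hxy.trans_lt (hεδ m)
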